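/- Let $B$ be the adjacency matrix of a cycle of length $4$ (any labelling of the vertices); its eigenvalues are $0, 2, -2$. Let $\mathbb{Z}[B]=\{f(B)\mid f\in\mathbb{Z}[x]\}$ be the subring of the ring of integral $4\times 4$ matrices generated by $B$. For every integer $n\ge 1$ the number $a_n$ of ideals of $\mathbb{Z}[B]$ of index $n$ is finite, and the Dirichlet series $\zeta_{\mathbb{Z}[B]}(s)=\sum_{n\ge 1}a_n n^{-s}$ satisfies $$\zeta_{\mathbb{Z}[B]}(s)=\left(16\cdot 2^{-8s}-16\cdot 2^{-7s}+12\cdot 2^{-6s}+2\cdot 2^{-4s}+3\cdot 2^{-2s}-2\cdot 2^{-s}+1\right)\zeta(s)^3,$$ where $\zeta(s)$ is the Riemann zeta function. The identity holds between formal Dirichlet series, and also between (absolutely convergent) analytic functions for $\operatorname{Re} s>1$. -/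

import Mathlib

/-- The ring `ℤ[B] = {f(B) ∣ f ∈ ℤ[x]}`: the (unital) subring of the full matrix ring generated
by the integral square matrix `B`. -/
abbrev matrixRing {V : Type*} [Fintype V] [DecidableEq V] (B : Matrix V V ℤ) :
    Subalgebra ℤ (Matrix V V ℤ) :=
  Algebra.adjoin ℤ {B}

/-- The set of ideals of `R` whose index, as additive subgroups, is `n`. (For `n = 0` these are
the ideals of infinite index.) For a commutative ring, such as `ℤ[B]`, `Ideal` (in general: left
ideal) has its usual meaning. -/
def idealsOfIndex (R : Type*) [Ring R] (n : ℕ) : Set (Ideal R) :=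
  {I | I.toAddSubgroup.index = n}

/-- The formal Dirichlet series `∑_{n ≥ 1} aₙ n^{-s}`, where `aₙ` is the number of ideals of `R`
of index `n`. Formal Dirichlet series over `ℤ` are Mathlib's `ArithmeticFunction ℤ`, whose
product is Dirichlet convolution. -/
noncomputable def idealZeta (R : Type*) [Ring R] : ArithmeticFunction ℤ where
  toFun n := if n = 0 then 0 else ((idealsOfIndex R n).ncard : ℤ)
  map_zero' := if_pos rfl

/-- The formal Dirichlet series `n^{-s}`, for `n ≥ 1` (and `0` for `n = 0`): its coefficient is
`1` at `n` and `0` elsewhere. -/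
def dirichletMonomial (n : ℕ) : ArithmeticFunction ℤ where
  toFun m := if m ≠ 0 ∧ m = n then 1 else 0
  map_zero' := if_neg fun h => h.1 rfl

/-! Since `B` satisfies `x ^ 3 = 4 * x` and no monic relation of smaller degree, `1, x, x * (x - 2)`
is a `ℤ`-basis of `ℤ[B]`. In this basis multiplication by `x` is triangular with diagonal `0, 2,
-2`. An ideal of index `n` is therefore a sublattice of `ℤ³` of index `n` stable under one
triangular map.

Such a lattice has a unique Hermite normal form with diagonal `(a, b, c)`, `a * b * c = n`, and
stability becomes three congruences on the off-diagonal entries (`rowLattice_stable_iff`). Their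
only coefficients besides the unknowns are `2` and `4`, so the number of solutions depends only on
2-adic divisibility of `a`, `b`, `c`. It is a combination of products with at most one indicator `[2
^ i ∣ ·]` in each of `a`, `b`, `c` (`card_stableEntries_eq`).

The indicator of `2 ^ i ∣ n` has Dirichlet series `2 ^ (-i s) ζ(s)`. Summing over `a * b * c = n`
turns a product of three indicators into `2 ^ (-(i + j + k) s) ζ(s) ^ 3`, and adding these terms
gives the polynomial factor (`IsCycleBasis.idealZeta_eq`). -/

open Finset in
/-- The off-diagonal entries `(k, l, m)` of the reduced matrices with rows `(a, l, m)`, `(0, b, k)`,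
`(0, 0, c)` whose row lattice is stable under `(u, v, w) ↦ (0, u + 2 * v, v - 2 * w)`. -/
noncomputable def stableEntries (a b c : ℕ) : Finset (ℤ × ℤ × ℤ) :=
  {p ∈ Ico (0 : ℤ) c ×ˢ Ico (0 : ℤ) b ×ˢ Ico (0 : ℤ) c |
    (c : ℤ) ∣ b - 4 * p.1 ∧ (b : ℤ) ∣ a + 2 * p.2.1 ∧
      (c : ℤ) ∣ p.2.1 - 2 * p.2.2 - (a + 2 * p.2.1) / b * p.1}

lemma mem_stableEntries {a b c : ℕ} {k l m : ℤ} :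
    (k, l, m) ∈ stableEntries a b c ↔ ((0 ≤ k ∧ k < c) ∧ (0 ≤ l ∧ l < b) ∧ (0 ≤ m ∧ m < c)) ∧
      (c : ℤ) ∣ b - 4 * k ∧ (b : ℤ) ∣ a + 2 * l ∧
      (c : ℤ) ∣ l - 2 * m - (a + 2 * l) / b * k := by
  simp [stableEntries]

/-! ### Counting the solutions of the stability congruences -/

section Counting

open Finset

lemma sum_Ico_ite_dvd_sub {e : ℤ} (he : 0 < e) (y : ℤ) (g : ℤ → ℤ) :
    ∑ m ∈ Ico 0 e, (if e ∣ m - y then g m else 0) = g (y % e) := by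
  rw [sum_eq_single_of_mem (y % e)]
  · rw [if_pos]
    exact ⟨-(y / e), by linarith [Int.emod_add_mul_ediv y e]⟩
  · simp [Int.emod_nonneg y he.ne', Int.emod_lt_of_pos y he]
  · intro m hm hne
    rw [mem_Ico] at hm
    refine if_neg fun h => hne ?_
    rw [← Int.emod_eq_of_lt hm.1 hm.2]
    exact (Int.modEq_iff_dvd.2 h).symm

lemma sum_Ico_mul_ite_dvd_sub (d : ℕ) {e : ℤ} (he : 0 < e) (y : ℤ) :
    ∑ m ∈ Ico 0 (d * e), (if e ∣ m - y then 1 else 0 : ℤ) = d := by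
  have h := Int.Ico_filter_modEq_card 0 (d * e) he y
  -- The count is a difference of two ceilings whose arguments differ by exactly `d` periods.
  have h2 : ((((d * e : ℤ) : ℚ) - y) / (e : ℚ)) = ((0 : ℤ) - y) / (e : ℚ) + (d : ℤ) := by
    have : (e : ℚ) ≠ 0 := by exact_mod_cast he.ne'
    push_cast
    field_simp
    ring
  rw [h2, Int.ceil_add_intCast, add_sub_cancel_left, max_eq_left (by positivity)] at h
  refine Eq.trans ?_ h
  rw [card_filter]
  push_cast
  refine sum_congr rfl fun m _ => ?_
  simp only [Int.modEq_comm (a := m), Int.modEq_iff_dvd]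

lemma sum_Ico_ite_dvd_sub_mul {g e : ℤ} (he : 0 < e) (hg : IsCoprime g e) (z : ℤ) :
    ∑ m ∈ Ico 0 e, (if e ∣ z - g * m then 1 else 0 : ℤ) = 1 := by
  obtain ⟨u, v, huv⟩ := hg
  refine Eq.trans ?_ (sum_Ico_ite_dvd_sub he (u * z) fun _ => 1)
  refine sum_congr rfl fun m _ => if_congr ⟨?_, ?_⟩ rfl rfl
  · rintro ⟨q, hq⟩
    exact ⟨-u * q + v * m, by linear_combination -u * hq - m * huv⟩
  · rintro ⟨q, hq⟩
    exact ⟨-g * q + v * z, by linear_combination -g * hq - z * huv⟩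

lemma sum_Ico_two_mul_ite_dvd {e : ℤ} (he : 0 < e) (z : ℤ) :
    ∑ m ∈ Ico 0 (2 * e), (if 2 * e ∣ z - 2 * m then 1 else 0 : ℤ) = if 2 ∣ z then 2 else 0 := by
  split_ifs with hz
  · obtain ⟨y, rfl⟩ := hz
    have := sum_Ico_mul_ite_dvd_sub 2 he y
    rw [Nat.cast_ofNat] at this
    refine Eq.trans ?_ this
    refine sum_congr rfl fun m _ => if_congr ?_ rfl rfl
    rw [← mul_sub, mul_dvd_mul_iff_left two_ne_zero, dvd_sub_comm]
  · refine sum_eq_zero fun m _ => if_neg fun h => hz ?_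
    have := (dvd_mul_right 2 e).trans h
    omega

/-- The congruence `2 * a + 2 * l ≡ 0` modulo `2 * b` has the two solutions `-a` and `b - a`. -/
lemma sum_Ico_two_mul_ite_dvd_add {b a : ℤ} (hb : 0 < b) (g : ℤ → ℤ) :
    ∑ l ∈ Ico 0 (2 * b), (if 2 * b ∣ 2 * a + 2 * l then g l else 0) =
      g (-a % (2 * b)) + g ((b - a) % (2 * b)) := by
  rw [← sum_Ico_ite_dvd_sub (by omega) (-a) g, ← sum_Ico_ite_dvd_sub (by omega) (b - a) g,
    ← sum_add_distrib]
  refine sum_congr rfl fun l _ => ?_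
  have key : 2 * b ∣ 2 * a + 2 * l ↔ (2 * b ∣ l - -a ∨ 2 * b ∣ l - (b - a)) := by
    rw [← mul_add, mul_dvd_mul_iff_left two_ne_zero]
    constructor
    · rintro ⟨q, hq⟩
      rcases Int.even_or_odd' q with ⟨r, rfl | rfl⟩
      · exact Or.inl ⟨r, by linear_combination hq⟩
      · exact Or.inr ⟨r, by linear_combination hq⟩
    · rintro (⟨q, hq⟩ | ⟨q, hq⟩)
      · exact ⟨2 * q, by linear_combination hq⟩
      · exact ⟨2 * q + 1, by linear_combination hq⟩
  have excl : ¬ (2 * b ∣ l - -a ∧ 2 * b ∣ l - (b - a)) := by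
    rintro ⟨⟨q, hq⟩, ⟨r, hr⟩⟩
    have h1 : b * 1 = b * (2 * (q - r)) := by linear_combination hq - hr
    have := mul_left_cancel₀ hb.ne' h1
    omega
  by_cases h1 : 2 * b ∣ l - -a <;> by_cases h2 : 2 * b ∣ l - (b - a) <;> simp_all

lemma card_stableEntries (a b c : ℕ) : ((stableEntries a b c).card : ℤ) =
    ∑ k ∈ Ico (0 : ℤ) c, if (c : ℤ) ∣ b - 4 * k then
      ∑ l ∈ Ico (0 : ℤ) b, if (b : ℤ) ∣ a + 2 * l then
        ∑ m ∈ Ico (0 : ℤ) c, if (c : ℤ) ∣ l - (a + 2 * l) / b * k - 2 * m then 1 else 0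
      else 0 else 0 := by
  rw [stableEntries, card_filter]
  push_cast
  rw [sum_product]
  refine sum_congr rfl fun k _ => ?_
  rw [sum_product]
  split_ifs with hk
  · refine sum_congr rfl fun l _ => ?_
    split_ifs with hl
    · refine sum_congr rfl fun m _ => if_congr ?_ rfl rfl
      simp [hk, hl, sub_right_comm]
    · simp [hl]
  · simp [hk]

/-- Modulo an odd `c` both `2` and `4` are invertible, so `k` and `m` are determined and only `a + 2
* l ≡ 0` modulo `b` is left to count. -/
lemma card_stableEntries_of_odd {a b c : ℕ} (hb : 0 < b) (hc : ¬ 2 ∣ c) :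
    ((stableEntries a b c).card : ℤ) = if 2 ∣ b then if 2 ∣ a then 2 else 0 else 1 := by
  have hc0 : 0 < c := by omega
  have h2 : IsCoprime (2 : ℤ) c := by
    exact_mod_cast Nat.isCoprime_iff_coprime.2 ((Nat.Prime.coprime_iff_not_dvd Nat.prime_two).2 hc)
  have h4 : IsCoprime (4 : ℤ) c := by simpa using h2.pow_left (m := 2)
  rw [card_stableEntries]
  simp_rw [sum_Ico_ite_dvd_sub_mul (by omega : (0 : ℤ) < c) h2]
  rw [← sum_filter, sum_const, nsmul_eq_mul, card_filter]
  push_cast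
  rw [sum_Ico_ite_dvd_sub_mul (by omega : (0 : ℤ) < c) h4, one_mul]
  have hswap (l : ℤ) : (b : ℤ) ∣ a + 2 * l ↔ (b : ℤ) ∣ -a - 2 * l := by
    rw [← dvd_neg, neg_add']
  simp_rw [hswap]
  split_ifs with hb2 ha2
  · obtain ⟨b, rfl⟩ := hb2
    push_cast
    rw [sum_Ico_two_mul_ite_dvd (by omega), if_pos (by omega)]
  · obtain ⟨b, rfl⟩ := hb2
    push_cast
    rw [sum_Ico_two_mul_ite_dvd (by omega), if_neg (by omega)]
  · refine sum_Ico_ite_dvd_sub_mul (by omega) ?_ _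
    exact_mod_cast Nat.isCoprime_iff_coprime.2 ((Nat.Prime.coprime_iff_not_dvd Nat.prime_two).2 hb2)

/-- For even `c`, the count reduces to one over the solutions `k` of `c ∣ b - 4 * k`. -/
lemma card_stableEntries_of_even {a b c : ℕ} (hb : 0 < b) (hc : 0 < c) :
    ((stableEntries (2 * a) (2 * b) (2 * c)).card : ℤ) =
      ∑ k ∈ Ico (0 : ℤ) (2 * c), if (2 * c : ℤ) ∣ 2 * b - 4 * k then
        ((if 2 ∣ a then 2 else 0) + if (2 : ℤ) ∣ k - (b - a) then 2 else 0) else 0 := by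
  rw [card_stableEntries]
  push_cast
  refine sum_congr rfl fun k _ => ?_
  by_cases hk : (2 * c : ℤ) ∣ 2 * b - 4 * k
  swap
  · rw [if_neg hk, if_neg hk]
  rw [if_pos hk, if_pos hk]
  simp_rw [sum_Ico_two_mul_ite_dvd (by omega : (0 : ℤ) < c)]
  rw [sum_Ico_two_mul_ite_dvd_add (by omega : (0 : ℤ) < b)]
  have hb2 : (2 * b : ℤ) ≠ 0 := by omega
  congr 1
  -- For `l ≡ -a` the quotient is even, so `k` drops out of the parity condition for `m`; for `l ≡ b
  -- - a` below it is odd and `k` stays.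
  · have h := Int.emod_add_mul_ediv (-a) (2 * b)
    generalize (-a : ℤ) / (2 * b) = q at h
    generalize (-a : ℤ) % (2 * b) = l at h
    have hq : (2 * a + 2 * l : ℤ) / (2 * b) = -(2 * q) :=
      Int.ediv_eq_of_eq_mul_right hb2 (by linear_combination 2 * h)
    rw [hq]
    refine if_congr ?_ rfl rfl
    have hz : l - -(2 * q) * k = -a + 2 * (q * k - b * q) := by linear_combination h
    rw [hz]
    omega
  · have h := Int.emod_add_mul_ediv (b - a) (2 * b)
    generalize (b - a : ℤ) / (2 * b) = q at h
    generalize (b - a : ℤ) % (2 * b) = l at h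
    have hq : (2 * a + 2 * l : ℤ) / (2 * b) = 1 - 2 * q :=
      Int.ediv_eq_of_eq_mul_right hb2 (by linear_combination 2 * h)
    rw [hq]
    refine if_congr ?_ rfl rfl
    have hz : l - (1 - 2 * q) * k = b - a - k + 2 * (q * k - b * q) := by linear_combination h
    rw [hz]
    omega

lemma card_stableEntries_of_not_dvd {a b c : ℕ} (hc : 2 ∣ c) (h : ¬ (2 ∣ a ∧ 2 ∣ b)) :
    (stableEntries a b c).card = 0 := by
  rw [card_eq_zero, eq_empty_iff_forall_notMem]
  rintro ⟨k, l, m⟩ hp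
  rw [mem_stableEntries] at hp
  obtain ⟨-, ⟨q, hq⟩, ⟨r, hr⟩, -⟩ := hp
  obtain ⟨c, rfl⟩ := hc
  have hb : (2 : ℤ) ∣ b := ⟨c * q + 2 * k, by push_cast at hq; linear_combination hq⟩
  have ha : (2 : ℤ) ∣ a := by
    obtain ⟨b', hb'⟩ := hb
    exact ⟨b' * r - l, by rw [hb'] at hr; linear_combination hr⟩
  omega

lemma sum_Ico_ite_add_ite {S : Finset ℤ} {p q : ℤ → Prop} [DecidablePred p] [DecidablePred q]
    (A B : ℤ) : ∑ k ∈ S, (if p k then A + (if q k then B else 0) else 0) =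
      A * ∑ k ∈ S, (if p k then 1 else 0 : ℤ) + B * ∑ k ∈ S, (if p k ∧ q k then 1 else 0 : ℤ) := by
  rw [mul_sum, mul_sum, ← sum_add_distrib]
  refine sum_congr rfl fun k _ => ?_
  by_cases hp : p k <;> by_cases hq : q k <;> simp [hp, hq]

/-- Chinese remainder theorem: as `e` is odd, `y + e * (z - y)` is `y` modulo `e` and `z` modulo
`2`. -/
lemma dvd_sub_and_two_dvd_sub_iff {e : ℤ} (he : ¬ 2 ∣ e) (y z k : ℤ) :
    e ∣ k - y ∧ 2 ∣ k - z ↔ 2 * e ∣ k - (y + e * (z - y)) := by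
  obtain ⟨j, rfl⟩ : ∃ j, e = 2 * j + 1 := ⟨e / 2, by omega⟩
  constructor
  · rintro ⟨⟨q, hq⟩, ⟨r, hr⟩⟩
    have h1 : k - (y + (2 * j + 1) * (z - y)) = (2 * j + 1) * (q - (z - y)) := by
      linear_combination hq
    have h2 : k - (y + (2 * j + 1) * (z - y)) = 2 * (r - j * (z - y)) := by
      linear_combination hr
    have hc : IsCoprime (2 : ℤ) (2 * j + 1) := ⟨-j, 1, by ring⟩
    exact hc.mul_dvd ⟨_, h2⟩ ⟨_, h1⟩
  · rintro ⟨q, hq⟩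
    exact ⟨⟨2 * q + (z - y), by linear_combination hq⟩,
      ⟨(2 * j + 1) * q + j * (z - y), by linear_combination hq⟩⟩

/-- There are two admissible `k` modulo `2 * c`, one of each parity: the first summand contributes
`4` or `0`, the second always `2`. -/
lemma card_stableEntries_two_mul_of_odd {a b c : ℕ} (hb : 0 < b) (hc : ¬ 2 ∣ c) :
    ((stableEntries (2 * a) (2 * b) (2 * c)).card : ℤ) = if 2 ∣ a then 6 else 2 := by
  have hc0 : (0 : ℤ) < c := by omega
  have hc2 : ¬ (2 : ℤ) ∣ c := by omega
  rw [card_stableEntries_of_even hb (by omega), sum_Ico_ite_add_ite]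
  obtain ⟨j, hj⟩ : ∃ j : ℤ, (c : ℤ) = 2 * j + 1 := ⟨c / 2, by omega⟩
  -- `j + 1` is the inverse of `2` modulo `c = 2 * j + 1`.
  have hk (k : ℤ) : (2 * c : ℤ) ∣ 2 * b - 4 * k ↔ (c : ℤ) ∣ k - (j + 1) * b := by
    rw [show (2 * b - 4 * k : ℤ) = 2 * (b - 2 * k) by ring, mul_dvd_mul_iff_left two_ne_zero]
    constructor
    · rintro ⟨q, hq⟩
      exact ⟨-k - (j + 1) * q, by linear_combination -(j + 1) * hq + k * hj⟩
    · rintro ⟨q, hq⟩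
      exact ⟨-(2 * q) - b, by linear_combination -2 * hq + b * hj⟩
  simp_rw [hk, dvd_sub_and_two_dvd_sub_iff hc2]
  rw [sum_Ico_ite_dvd_sub (by omega), ← Nat.cast_ofNat (R := ℤ) (n := 2),
    sum_Ico_mul_ite_dvd_sub 2 hc0]
  split_ifs <;> rfl

lemma card_stableEntries_four_mul_of_odd {a b c : ℕ} (hb : ¬ 2 ∣ b) (hc : 0 < c) :
    ((stableEntries (2 * a) (2 * b) (4 * c)).card : ℤ) = 0 := by
  rw [show 4 * c = 2 * (2 * c) by ring, card_stableEntries_of_even (by omega) (by omega)]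
  refine sum_eq_zero fun k _ => if_neg ?_
  rintro ⟨q, hq⟩
  have : (b : ℤ) = 2 * (c * q + k) := by push_cast at hq; linarith
  omega

/-- The admissible `k` are four lifts of `b` modulo `c`. For even `c` all have the parity of `b`, so
the parity condition holds for all or none; for odd `c` it selects two of them. -/
lemma card_stableEntries_four_mul {a b c : ℕ} (hb : 0 < b) (hc : 0 < c) :
    ((stableEntries (2 * a) (4 * b) (4 * c)).card : ℤ) =
      (if 2 ∣ a then 8 else 0) + if 2 ∣ c then if 2 ∣ a + b then 8 else 0 else 4 := by
  have hc0 : (0 : ℤ) < c := by omega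
  rw [show 4 * c = 2 * (2 * c) by ring, show 4 * b = 2 * (2 * b) by ring,
    card_stableEntries_of_even (by omega) (by omega), sum_Ico_ite_add_ite]
  have hk (k : ℤ) : (2 * (2 * c) : ℤ) ∣ 2 * (2 * b) - 4 * k ↔ (c : ℤ) ∣ k - b := by
    rw [show (2 * (2 * b) - 4 * k : ℤ) = 4 * (b - k) by ring,
      show (2 * (2 * c) : ℤ) = 4 * c by ring, mul_dvd_mul_iff_left (by norm_num), dvd_sub_comm]
  push_cast
  simp_rw [hk]
  have h4 := sum_Ico_mul_ite_dvd_sub 4 hc0 b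
  rw [show (((4 : ℕ) : ℤ) * c) = 2 * (2 * c) by push_cast; ring] at h4
  rw [h4]
  congr 1
  · split_ifs <;> rfl
  by_cases hc2 : 2 ∣ c
  · have hk2 (k : ℤ) : ((c : ℤ) ∣ k - b ∧ 2 ∣ k - (2 * b - a)) ↔ (c : ℤ) ∣ k - b ∧ 2 ∣ a + b := by
      refine and_congr_right fun h => ?_
      have : (2 : ℤ) ∣ k - b := (by exact_mod_cast hc2 : (2 : ℤ) ∣ c).trans h
      omega
    simp_rw [hk2]
    by_cases hab : 2 ∣ a + b
    · simp [hab, hc2, h4]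
    · simp [hab, hc2]
  · simp_rw [dvd_sub_and_two_dvd_sub_iff (by omega : ¬ (2 : ℤ) ∣ c)]
    have h2 := sum_Ico_mul_ite_dvd_sub 2 (mul_pos two_pos hc0) (b + c * (2 * b - a - b))
    rw [Nat.cast_ofNat] at h2
    rw [h2, if_neg hc2]
    rfl

/-- The number of stable matrices with given diagonal, as a combination of divisibility indicators
by powers of two. -/
lemma card_stableEntries_eq {a b c : ℕ} (ha : 0 < a) (hb : 0 < b) (hc : 0 < c) (I : ℕ → ℕ → ℤ)
    (hI : ∀ i n, n ≠ 0 → I i n = if 2 ^ i ∣ n then 1 else 0) :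
    ((stableEntries a b c).card : ℤ) =
      (1 - I 1 c) * (1 - I 1 b + 2 * (I 1 a * I 1 b))
      + (I 1 c - I 2 c) * I 1 b * (2 * I 1 a + 4 * I 2 a)
      + I 2 b * (8 * I 2 a * I 2 c + 4 * I 1 a * (I 2 c - I 3 c))
      + 8 * I 3 c * (I 2 a * I 3 b + (I 1 a - I 2 a) * (I 2 b - I 3 b)) := by
  have h1 (n : ℕ) : (2 ^ 1 ∣ n) = (2 ∣ n) := rfl
  have h2 (n : ℕ) : (2 ^ 2 ∣ n) = (4 ∣ n) := rfl
  have h3 (n : ℕ) : (2 ^ 3 ∣ n) = (8 ∣ n) := rfl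
  simp only [hI _ _ ha.ne', hI _ _ hb.ne', hI _ _ hc.ne', h1, h2, h3]
  have d1 (n : ℕ) : 4 ∣ n → 2 ∣ n := by omega
  have d2 (n : ℕ) : 8 ∣ n → 4 ∣ n := by omega
  by_cases c1 : 2 ∣ c
  swap
  · have c2 : ¬ 4 ∣ c := fun h => c1 (d1 c h)
    have c3 : ¬ 8 ∣ c := fun h => c2 (d2 c h)
    rw [card_stableEntries_of_odd hb c1]
    by_cases b1 : 2 ∣ b <;> by_cases a1 : 2 ∣ a <;> simp [*]
  by_cases hab : 2 ∣ a ∧ 2 ∣ b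
  swap
  · rw [card_stableEntries_of_not_dvd c1 hab]
    by_cases a1 : 2 ∣ a
    · have b1 : ¬ 2 ∣ b := fun h => hab ⟨a1, h⟩
      have b2 : ¬ 4 ∣ b := fun h => b1 (d1 b h)
      have b3 : ¬ 8 ∣ b := fun h => b2 (d2 b h)
      simp [*]
    · have a2 : ¬ 4 ∣ a := fun h => a1 (d1 a h)
      simp [*]
  obtain ⟨⟨a, rfl⟩, ⟨b, rfl⟩⟩ := hab
  have e1 (n : ℕ) : 4 ∣ 2 * n ↔ 2 ∣ n := by omega
  by_cases c2 : 4 ∣ c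
  swap
  · have c3 : ¬ 8 ∣ c := fun h => c2 (d2 c h)
    obtain ⟨c, rfl⟩ := c1
    rw [card_stableEntries_two_mul_of_odd (by omega) (by omega)]
    have c4 : ¬ 2 ∣ c := by omega
    by_cases a2 : 2 ∣ a <;> simp [*]
  obtain ⟨c, rfl⟩ := c2
  by_cases b2 : 2 ∣ b
  swap
  · have b3 : ¬ 8 ∣ 2 * b := by omega
    rw [card_stableEntries_four_mul_of_odd b2 (by omega)]
    simp [*]
  obtain ⟨b, rfl⟩ := b2
  rw [show 2 * (2 * b) = 4 * b by ring, card_stableEntries_four_mul (by omega) (by omega)]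
  have e2 (n : ℕ) : 8 ∣ 4 * n ↔ 2 ∣ n := by omega
  have e3 (n : ℕ) : 2 ∣ 4 * n := by omega
  simp only [e1, e2, e3, dvd_mul_right, if_true]
  by_cases a2 : 2 ∣ a <;> by_cases c3 : 2 ∣ c <;> by_cases b3 : 2 ∣ b <;>
    simp [*, Nat.dvd_add_right, Nat.dvd_add_left]
  omega

end Counting

/-! ### Hermite normal forms and stable sublattices of `ℤ³` -/

/-- The row lattice of the upper triangular matrix with rows `(a, l, m)`, `(0, b, k)`,
`(0, 0, c)`. -/
def rowLattice (a b c k l m : ℤ) : AddSubgroup (ℤ × ℤ × ℤ) where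
  carrier := {v | ∃ p q r : ℤ, v = (p * a, p * l + q * b, p * m + q * k + r * c)}
  zero_mem' := ⟨0, 0, 0, by simp; rfl⟩
  add_mem' := by
    rintro _ _ ⟨p, q, r, rfl⟩ ⟨p', q', r', rfl⟩
    exact ⟨p + p', q + q', r + r', by ext <;> simp <;> ring⟩
  neg_mem' := by
    rintro _ ⟨p, q, r, rfl⟩
    exact ⟨-p, -q, -r, by ext <;> simp <;> ring⟩

lemma mem_rowLattice {a b c k l m : ℤ} {v : ℤ × ℤ × ℤ} : v ∈ rowLattice a b c k l m ↔
    ∃ p q r : ℤ, v = (p * a, p * l + q * b, p * m + q * k + r * c) := Iff.rfl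

lemma rowLattice_eq_closure (a b c k l m : ℤ) :
    rowLattice a b c k l m = AddSubgroup.closure {(a, l, m), (0, b, k), (0, 0, c)} := by
  refine le_antisymm ?_ ((AddSubgroup.closure_le _).2 ?_)
  · rintro _ ⟨p, q, r, rfl⟩
    have : (p * a, p * l + q * b, p * m + q * k + r * c) =
        p • ((a, l, m) : ℤ × ℤ × ℤ) + q • ((0, b, k) : ℤ × ℤ × ℤ) + r • ((0, 0, c) : ℤ × ℤ × ℤ) := by
      ext <;> simp
    rw [this]
    refine add_mem (add_mem ?_ ?_) ?_ <;>
      exact zsmul_mem (AddSubgroup.subset_closure (by simp)) _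
  · rintro v (rfl | rfl | rfl)
    · exact ⟨1, 0, 0, by simp⟩
    · exact ⟨0, 1, 0, by simp⟩
    · exact ⟨0, 0, 1, by simp⟩

open Finset in
lemma index_rowLattice {a b c : ℕ} (ha : 0 < a) (hb : 0 < b) (hc : 0 < c) (k l m : ℤ) :
    (rowLattice a b c k l m).index = a * b * c := by
  -- The box of reduced vectors represents each coset once: divide by `a`, `b`, `c` in turn,
  -- subtracting the multiple of the row just used.
  have hcompl : AddSubgroup.IsComplement
      (↑(Ico (0 : ℤ) a ×ˢ Ico (0 : ℤ) b ×ˢ Ico (0 : ℤ) c) : Set (ℤ × ℤ × ℤ))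
      (rowLattice a b c k l m : Set (ℤ × ℤ × ℤ)) := by
    rw [AddSubgroup.isComplement_iff_existsUnique_neg_add_mem]
    rintro ⟨u, v, w⟩
    have ha' : (a : ℤ) ≠ 0 := by omega
    have hb' : (b : ℤ) ≠ 0 := by omega
    have hc' : (c : ℤ) ≠ 0 := by omega
    let p := u / a
    let q := (v - p * l) / b
    let r := (w - p * m - q * k) / c
    refine ⟨⟨(u % a, (v - p * l) % b, (w - p * m - q * k) % c), ?_⟩, ?_, ?_⟩
    · simp [Int.emod_nonneg _ ha', Int.emod_nonneg _ hb', Int.emod_nonneg _ hc',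
        Int.emod_lt_of_pos _ (by omega : (0 : ℤ) < a), Int.emod_lt_of_pos _ (by omega : (0 : ℤ) < b),
        Int.emod_lt_of_pos _ (by omega : (0 : ℤ) < c)]
    · have h1 := Int.emod_add_mul_ediv u a
      have h2 := Int.emod_add_mul_ediv (v - p * l) b
      have h3 := Int.emod_add_mul_ediv (w - p * m - q * k) c
      refine ⟨p, q, r, ?_⟩
      ext
      · simp only [Prod.neg_mk, Prod.mk_add_mk]
        linear_combination -h1
      · simp only [Prod.neg_mk, Prod.mk_add_mk]
        linear_combination -h2
      · simp only [Prod.neg_mk, Prod.mk_add_mk]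
        linear_combination -h3
    · rintro ⟨⟨x, y, z⟩, hs⟩ ⟨p', q', r', h⟩
      simp only [coe_product, coe_Ico, Set.mem_prod, Set.mem_Ico] at hs
      simp only [Prod.neg_mk, Prod.mk_add_mk, Prod.mk.injEq] at h
      obtain ⟨h1, h2, h3⟩ := h
      obtain ⟨⟨hx, hx'⟩, ⟨hy, hy'⟩, ⟨hz, hz'⟩⟩ := hs
      obtain ⟨e1, e1'⟩ := (Int.ediv_emod_unique (by omega : (0 : ℤ) < a)).2
        ⟨(by linear_combination -h1 : x + a * p' = u), hx, hx'⟩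
      have hp : p = p' := e1
      obtain ⟨e2, e2'⟩ := (Int.ediv_emod_unique (by omega : (0 : ℤ) < b)).2
        ⟨(by rw [hp]; linear_combination -h2 : y + b * q' = v - p * l), hy, hy'⟩
      have hq : q = q' := e2
      obtain ⟨e3, e3'⟩ := (Int.ediv_emod_unique (by omega : (0 : ℤ) < c)).2
        ⟨(by rw [hp, hq]; linear_combination -h3 : z + c * r' = w - p * m - q * k), hz, hz'⟩
      simp only [e1', e2', e3']
  rw [← hcompl.ncard_left, Set.ncard_coe_finset]
  simp [mul_assoc]

/-- The lattice endomorphism `(u, v, w) ↦ (0, u + 2 * v, v - 2 * w)`. -/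
def cycleShift (v : ℤ × ℤ × ℤ) : ℤ × ℤ × ℤ := (0, v.1 + 2 * v.2.1, v.2.1 - 2 * v.2.2)

/-- It suffices to test the first two rows, since the last is always sent to `-2` times itself. -/
lemma rowLattice_stable_iff {a b c k l m : ℤ} (ha : a ≠ 0) (hb : b ≠ 0) :
    (∀ v ∈ rowLattice a b c k l m, cycleShift v ∈ rowLattice a b c k l m) ↔
      c ∣ b - 4 * k ∧ b ∣ a + 2 * l ∧ c ∣ l - 2 * m - (a + 2 * l) / b * k := by
  constructor
  · intro h
    obtain ⟨p, q, r, h1⟩ := h (0, b, k) ⟨0, 1, 0, by simp⟩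
    obtain ⟨p', q', r', h2⟩ := h (a, l, m) ⟨1, 0, 0, by simp⟩
    simp only [cycleShift, Prod.mk.injEq] at h1 h2
    obtain ⟨h11, h12, h13⟩ := h1
    obtain ⟨h21, h22, h23⟩ := h2
    have hp : p = 0 := by simpa [ha] using h11.symm
    have hp' : p' = 0 := by simpa [ha] using h21.symm
    subst hp hp'
    have hq : q = 2 := mul_right_cancel₀ hb (by linear_combination -h12)
    subst hq
    have hq' : a + 2 * l = b * q' := by linear_combination h22
    refine ⟨⟨r, by linear_combination h13⟩, ⟨q', hq'⟩, ⟨r', ?_⟩⟩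
    rw [hq', Int.mul_ediv_cancel_left _ hb]
    linear_combination h23
  · rintro ⟨⟨s, hs⟩, ⟨t, ht⟩, ⟨w, hw⟩⟩ _ ⟨p, q, r, rfl⟩
    rw [ht, Int.mul_ediv_cancel_left _ hb] at hw
    refine ⟨0, p * t + 2 * q, p * w + q * s - 2 * r, ?_⟩
    simp only [cycleShift, Prod.mk.injEq]
    refine ⟨by ring, by linear_combination p * ht, by linear_combination p * hw + q * hs⟩

lemma rowLattice_injective {a b c a' b' c' : ℕ} {k l m k' l' m' : ℤ}
    (ha : 0 < a) (hb : 0 < b) (ha' : 0 < a') (hb' : 0 < b')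
    (hk : 0 ≤ k ∧ k < c) (hl : 0 ≤ l ∧ l < b) (hm : 0 ≤ m ∧ m < c)
    (hk' : 0 ≤ k' ∧ k' < c') (hl' : 0 ≤ l' ∧ l' < b') (hm' : 0 ≤ m' ∧ m' < c')
    (h : rowLattice a b c k l m = rowLattice a' b' c' k' l' m') :
    a = a' ∧ b = b' ∧ c = c' ∧ k = k' ∧ l = l' ∧ m = m' := by
  have haz : (a : ℤ) ≠ 0 := by omega
  have haz' : (a' : ℤ) ≠ 0 := by omega
  have hbz : (b : ℤ) ≠ 0 := by omega
  have hbz' : (b' : ℤ) ≠ 0 := by omega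
  have small {x y n s : ℤ} (hx : 0 ≤ x ∧ x < n) (hy : 0 ≤ y ∧ y < n) (hxy : x = y + s * n) :
      x = y := by
    rw [← Int.emod_eq_of_lt hx.1 hx.2, ← Int.emod_eq_of_lt hy.1 hy.2, hxy, Int.add_mul_emod_self_right]
  -- An inclusion already forces divisibility of the diagonals; using both inclusions gives
  -- equality.
  have key {a b c a' b' c' : ℕ} {k l m k' l' m' : ℤ} (haz' : (a' : ℤ) ≠ 0) (hbz' : (b' : ℤ) ≠ 0)
      (h : rowLattice a b c k l m ≤ rowLattice a' b' c' k' l' m') :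
      a' ∣ a ∧ b' ∣ b ∧ c' ∣ c := by
    obtain ⟨p, q, r, h1⟩ := h (mem_rowLattice.2 ⟨1, 0, 0, rfl⟩)
    obtain ⟨p', q', r', h2⟩ := h (mem_rowLattice.2 ⟨0, 1, 0, rfl⟩)
    obtain ⟨p'', q'', r'', h3⟩ := h (mem_rowLattice.2 ⟨0, 0, 1, rfl⟩)
    simp only [Prod.mk.injEq] at h1 h2 h3
    obtain rfl : p' = 0 := mul_right_cancel₀ haz' (by linear_combination -h2.1)
    obtain rfl : p'' = 0 := mul_right_cancel₀ haz' (by linear_combination -h3.1)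
    obtain rfl : q'' = 0 := mul_right_cancel₀ hbz' (by linear_combination -h3.2.1)
    refine ⟨Int.natCast_dvd_natCast.1 ⟨p, by linarith [h1.1]⟩,
      Int.natCast_dvd_natCast.1 ⟨q', by linarith [h2.2.1]⟩,
      Int.natCast_dvd_natCast.1 ⟨r'', by linarith [h3.2.2]⟩⟩
  obtain ⟨d1, d2, d3⟩ := key haz' hbz' h.le
  obtain ⟨d1', d2', d3'⟩ := key haz hbz h.ge
  obtain rfl := Nat.dvd_antisymm d1' d1
  obtain rfl := Nat.dvd_antisymm d2' d2
  obtain rfl := Nat.dvd_antisymm d3' d3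
  obtain ⟨p, q, r, h1⟩ := h.le (mem_rowLattice.2 ⟨1, 0, 0, rfl⟩)
  obtain ⟨p', q', r', h2⟩ := h.le (mem_rowLattice.2 ⟨0, 1, 0, rfl⟩)
  simp only [Prod.mk.injEq] at h1 h2
  obtain ⟨h11, h12, h13⟩ := h1
  obtain ⟨h21, h22, h23⟩ := h2
  obtain rfl : p' = 0 := mul_right_cancel₀ haz (by linear_combination -h21)
  obtain rfl : q' = 1 := mul_right_cancel₀ hbz (by linear_combination -h22)
  obtain rfl : p = 1 := mul_right_cancel₀ haz (by linear_combination -h11)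
  obtain rfl := small (s := r') hk hk' (by linear_combination h23)
  obtain rfl := small (s := q) hl hl' (by linear_combination h12)
  obtain rfl : q = 0 := mul_right_cancel₀ hbz (by linear_combination -h12)
  obtain rfl := small (s := r) hm hm' (by linear_combination h13)
  simp

/-- A nontrivial subgroup of the integers is generated by a positive natural number. -/
lemma AddSubgroup.exists_pos_forall_mem_iff_dvd (H : AddSubgroup ℤ) {n : ℤ} (hn : n ≠ 0)
    (hH : n ∈ H) : ∃ d : ℕ, 0 < d ∧ ∀ x, x ∈ H ↔ (d : ℤ) ∣ x := by
  obtain ⟨g, rfl⟩ := Int.subgroup_cyclic H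
  simp only [← AddSubgroup.zmultiples_eq_closure, Int.mem_zmultiples_iff] at hH ⊢
  refine ⟨g.natAbs, ?_, fun x => ?_⟩
  · rw [Int.natAbs_pos]
    rintro rfl
    exact hn (zero_dvd_iff.1 hH)
  · rw [Int.natAbs_dvd]

/-- Hermite normal form of sublattices of finite index in `ℤ³`. -/
lemma exists_eq_rowLattice {H : AddSubgroup (ℤ × ℤ × ℤ)} (hH : H.index ≠ 0) :
    ∃ a b c : ℕ, 0 < a ∧ 0 < b ∧ 0 < c ∧ ∃ k l m : ℤ, (0 ≤ k ∧ k < c) ∧ (0 ≤ l ∧ l < b) ∧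
      (0 ≤ m ∧ m < c) ∧ H = rowLattice a b c k l m := by
  set n : ℤ := (H.index : ℤ) with hn
  have hn0 : n ≠ 0 := by omega
  have hmem (v : ℤ × ℤ × ℤ) : n • v ∈ H := by
    rw [hn, natCast_zsmul]
    exact H.nsmul_index_mem v
  -- `c`, `b`, `a` generate the leading coefficients of the vectors in `H` of shape `(0, 0, *)`,
  -- `(0, *, *)`, `(*, *, *)`. These groups are nontrivial because the index kills the quotient.
  obtain ⟨c, hc0, hc⟩ := AddSubgroup.exists_pos_forall_mem_iff_dvd
    (H.comap ((AddMonoidHom.inr ℤ (ℤ × ℤ)).comp (AddMonoidHom.inr ℤ ℤ))) hn0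
    (by simpa using hmem (0, 0, 1))
  obtain ⟨b, hb0, hb⟩ := AddSubgroup.exists_pos_forall_mem_iff_dvd
    ((H.comap (AddMonoidHom.inr ℤ (ℤ × ℤ))).map (AddMonoidHom.fst ℤ ℤ)) hn0
    ⟨(n, 0), by simpa using hmem (0, 1, 0), rfl⟩
  obtain ⟨a, ha0, ha⟩ := AddSubgroup.exists_pos_forall_mem_iff_dvd
    (H.map (AddMonoidHom.fst ℤ (ℤ × ℤ))) hn0
    ⟨(n, 0, 0), by simpa using hmem (1, 0, 0), rfl⟩
  have hcH : ((0, 0, (c : ℤ)) : ℤ × ℤ × ℤ) ∈ H := (hc c).2 dvd_rfl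
  obtain ⟨⟨b', k₀⟩, hk₀, rfl : b' = b⟩ := (hb b).2 dvd_rfl
  obtain ⟨⟨a', l₀, m₀⟩, hm₀, rfl : a' = a⟩ := (ha a).2 dvd_rfl
  change ((0, (b : ℤ), k₀) : ℤ × ℤ × ℤ) ∈ H at hk₀
  let k := k₀ % c
  let l := l₀ % b
  let m := (m₀ - l₀ / b * k) % c
  have hk : ((0, (b : ℤ), k) : ℤ × ℤ × ℤ) ∈ H := by
    convert sub_mem hk₀ (zsmul_mem hcH (k₀ / c)) using 1
    have := Int.emod_add_mul_ediv k₀ c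
    ext <;> simp [k]
    linear_combination this
  have hm : (((a : ℤ), l, m) : ℤ × ℤ × ℤ) ∈ H := by
    convert sub_mem (sub_mem hm₀ (zsmul_mem hk (l₀ / b)))
      (zsmul_mem hcH ((m₀ - l₀ / b * k) / c)) using 1
    have h1 := Int.emod_add_mul_ediv l₀ b
    have h2 := Int.emod_add_mul_ediv (m₀ - l₀ / b * k) c
    ext
    · simp
    · simp [l]
      linear_combination h1
    · simp [m]
      linear_combination h2
  refine ⟨a, b, c, ha0, hb0, hc0, k, l, m,
    ⟨Int.emod_nonneg _ (by omega), Int.emod_lt_of_pos _ (by omega)⟩,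
    ⟨Int.emod_nonneg _ (by omega), Int.emod_lt_of_pos _ (by omega)⟩,
    ⟨Int.emod_nonneg _ (by omega), Int.emod_lt_of_pos _ (by omega)⟩, le_antisymm ?_ ?_⟩
  · rintro ⟨u, v, w⟩ hv
    obtain ⟨p, hp⟩ := (ha u).1 ⟨_, hv, rfl⟩
    have h1 : ((0, v - p * l, w - p * m) : ℤ × ℤ × ℤ) ∈ H := by
      convert sub_mem hv (zsmul_mem hm p) using 1
      ext <;> simp
      linear_combination -hp
    obtain ⟨q, hq⟩ := (hb (v - p * l)).1 ⟨(_, _), h1, rfl⟩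
    have h2 : ((0, 0, w - p * m - q * k) : ℤ × ℤ × ℤ) ∈ H := by
      convert sub_mem h1 (zsmul_mem hk q) using 1
      ext <;> simp
      linear_combination -hq
    obtain ⟨r, hr⟩ := (hc (w - p * m - q * k)).1 h2
    refine ⟨p, q, r, ?_⟩
    ext
    · linear_combination hp
    · linear_combination hq
    · linear_combination hr
  · rw [rowLattice_eq_closure, AddSubgroup.closure_le]
    rintro v (rfl | rfl | rfl)
    exacts [hm, hk, hcH]

/-- The reduced upper triangular matrices of determinant `n` whose row lattice is stable under
`cycleShift`, as triples `((a, b * c), (b, c)), (k, l, m)`. -/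
noncomputable def stableMatrices (n : ℕ) :
    Finset (Σ _ : (Σ _ : ℕ × ℕ, ℕ × ℕ), ℤ × ℤ × ℤ) :=
  ((n.divisorsAntidiagonal).sigma fun p => p.2.divisorsAntidiagonal).sigma fun s =>
    stableEntries s.1.1 s.2.1 s.2.2

lemma card_stableMatrices (n : ℕ) : (stableMatrices n).card =
    ∑ p ∈ n.divisorsAntidiagonal, ∑ q ∈ p.2.divisorsAntidiagonal,
      (stableEntries p.1 q.1 q.2).card := by
  rw [stableMatrices, Finset.card_sigma, Finset.sum_sigma]

/-- The lattice attached to an element of `stableMatrices`. -/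
def matrixLattice (s : Σ _ : (Σ _ : ℕ × ℕ, ℕ × ℕ), ℤ × ℤ × ℤ) : AddSubgroup (ℤ × ℤ × ℤ) :=
  rowLattice s.1.1.1 s.1.2.1 s.1.2.2 s.2.1 s.2.2.1 s.2.2.2

lemma injOn_matrixLattice (n : ℕ) : Set.InjOn matrixLattice (stableMatrices n) := by
  rintro ⟨⟨⟨a, d⟩, ⟨b, c⟩⟩, ⟨k, l, m⟩⟩ h ⟨⟨⟨a', d'⟩, ⟨b', c'⟩⟩, ⟨k', l', m'⟩⟩ h' heq
  simp only [stableMatrices, Finset.coe_sigma, Set.mem_sigma_iff, Finset.mem_coe,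
    Nat.mem_divisorsAntidiagonal, mem_stableEntries] at h h'
  obtain ⟨⟨⟨rfl, h1⟩, rfl, h2⟩, ⟨hk, hl, hm⟩, -⟩ := h
  obtain ⟨⟨⟨h3, -⟩, rfl, h4⟩, ⟨hk', hl', hm'⟩, -⟩ := h'
  have ha : 0 < a := Nat.pos_of_ne_zero (left_ne_zero_of_mul h1)
  have ha' : 0 < a' := Nat.pos_of_ne_zero (left_ne_zero_of_mul (h3 ▸ h1))
  obtain ⟨rfl, rfl, rfl, rfl, rfl, rfl⟩ := rowLattice_injective ha (by omega) ha' (by omega)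
    hk hl hm hk' hl' hm' heq
  rfl

lemma image_matrixLattice {n : ℕ} (hn : n ≠ 0) : matrixLattice '' stableMatrices n =
    {H | H.index = n ∧ ∀ v ∈ H, cycleShift v ∈ H} := by
  ext H
  constructor
  · rintro ⟨⟨⟨⟨a, d⟩, ⟨b, c⟩⟩, ⟨k, l, m⟩⟩, h, rfl⟩
    simp only [stableMatrices, Finset.coe_sigma, Set.mem_sigma_iff, Finset.mem_coe,
      Nat.mem_divisorsAntidiagonal, mem_stableEntries] at h
    obtain ⟨⟨⟨rfl, h1⟩, rfl, h2⟩, ⟨hk, hl, hm⟩, hst⟩ := h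
    have ha : 0 < a := Nat.pos_of_ne_zero (left_ne_zero_of_mul h1)
    have hb : 0 < b := Nat.pos_of_ne_zero (left_ne_zero_of_mul h2)
    have hc : 0 < c := Nat.pos_of_ne_zero (right_ne_zero_of_mul h2)
    refine ⟨?_, (rowLattice_stable_iff (Int.natCast_ne_zero.2 ha.ne')
      (Int.natCast_ne_zero.2 hb.ne')).2 hst⟩
    rw [← mul_assoc]
    exact index_rowLattice ha hb hc k l m
  · rintro ⟨h1, h2⟩
    obtain ⟨a, b, c, ha, hb, hc, k, l, m, hk, hl, hm, rfl⟩ := exists_eq_rowLattice (h1 ▸ hn)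
    rw [index_rowLattice ha hb hc] at h1
    refine ⟨⟨⟨⟨a, b * c⟩, ⟨b, c⟩⟩, ⟨k, l, m⟩⟩, ?_, rfl⟩
    simp only [stableMatrices, Finset.coe_sigma, Set.mem_sigma_iff, Finset.mem_coe,
      Nat.mem_divisorsAntidiagonal, mem_stableEntries]
    exact ⟨⟨⟨by rw [← h1, mul_assoc], hn⟩, trivial, by positivity⟩, ⟨hk, hl, hm⟩,
      (rowLattice_stable_iff (by omega) (by omega)).1 h2⟩

/-! ### Ideals as stable lattices -/

section Ideals

variable {R : Type*} [Ring R] (e : ℤ × ℤ × ℤ ≃+ R) (x : R)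

/-- The conditions saying that `1, x, x ^ 2 - 2 * x` is a `ℤ`-basis of a ring and that
`x ^ 3 = 4 * x`: multiplication by `x` is `cycleShift` in coordinates. -/
structure IsCycleBasis : Prop where
  map_one : e (1, 0, 0) = 1
  map_cycleShift : ∀ v, e (cycleShift v) = x * e v

variable {e x}

lemma IsCycleBasis.image_comap (h : IsCycleBasis e x) (n : ℕ) :
    (fun I : Ideal R => I.toAddSubgroup.comap (e : ℤ × ℤ × ℤ →+ R)) '' idealsOfIndex R n =
      {H | H.index = n ∧ ∀ v ∈ H, cycleShift v ∈ H} := by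
  have hindex (H : AddSubgroup R) : (H.comap (e : ℤ × ℤ × ℤ →+ R)).index = H.index :=
    H.index_comap_of_surjective e.surjective
  ext H
  constructor
  · rintro ⟨I, hI, rfl⟩
    refine ⟨(hindex _).trans hI, fun v hv => ?_⟩
    change e (cycleShift v) ∈ I
    rw [h.map_cycleShift]
    exact I.mul_mem_left x hv
  · rintro ⟨h1, h2⟩
    have hx : e (0, 1, 0) = x := by
      rw [← mul_one x, ← h.map_one, ← h.map_cycleShift]
      rfl
    have hxx : e (0, 0, 1) = x * x - 2 * x := by
      have h3 : e (0, 2, 1) = x * x := by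
        rw [← congrArg (x * ·) hx, ← h.map_cycleShift]
        rfl
      have h4 : ((0, 0, 1) : ℤ × ℤ × ℤ) = (0, 2, 1) - (2 : ℕ) • (0, 1, 0) := by rfl
      rw [h4, map_sub, map_nsmul, h3, hx, nsmul_eq_mul]
      rfl
    have hexp (v : ℤ × ℤ × ℤ) : e v = v.1 • (1 : R) + v.2.1 • x + v.2.2 • (x * x - 2 * x) := by
      rw [← hxx, ← hx, ← h.map_one, ← map_zsmul, ← map_zsmul, ← map_zsmul, ← map_add, ← map_add]
      congr 1
      ext <;> simp
    -- Stability under `x` alone suffices, because every ring element is an integral combination of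
    -- `1`, `x` and `x * x - 2 * x`.
    let J : AddSubgroup R := H.comap (e.symm : R →+ ℤ × ℤ × ℤ)
    have hJ (r : R) (hr : r ∈ J) : x * r ∈ J := by
      change e.symm (x * r) ∈ H
      have h5 := h2 _ hr
      rwa [AddMonoidHom.coe_coe, ← e.symm_apply_apply (cycleShift _), h.map_cycleShift,
        e.apply_symm_apply] at h5
    let I : Ideal R :=
      { J with
        smul_mem' := fun c r hr => by
          change c * r ∈ J
          obtain ⟨v, rfl⟩ := e.surjective c
          have h6 : e v * r = v.1 • r + v.2.1 • (x * r) +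
              v.2.2 • (x * (x * r) - (x * r + x * r)) := by
            rw [hexp, add_mul, add_mul, smul_mul_assoc, smul_mul_assoc, smul_mul_assoc, one_mul,
              sub_mul, mul_assoc, mul_assoc, two_mul]
          rw [h6]
          have h7 := hJ r hr
          exact add_mem (add_mem (zsmul_mem hr _) (zsmul_mem h7 _))
            (zsmul_mem (sub_mem (hJ _ h7) (add_mem h7 h7)) _) }
    have hI : I.toAddSubgroup.comap (e : ℤ × ℤ × ℤ →+ R) = H := by
      ext v
      change e.symm (e v) ∈ H ↔ v ∈ H
      rw [e.symm_apply_apply]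
    exact ⟨I, by rw [← h1, ← hI, hindex]; rfl, hI⟩

lemma injective_comap_toAddSubgroup : Function.Injective
    fun I : Ideal R => I.toAddSubgroup.comap (e : ℤ × ℤ × ℤ →+ R) := by
  intro I J h
  ext r
  obtain ⟨v, rfl⟩ := e.surjective r
  exact SetLike.ext_iff.1 h v

lemma IsCycleBasis.finite_idealsOfIndex (h : IsCycleBasis e x) {n : ℕ} (hn : n ≠ 0) :
    (idealsOfIndex R n).Finite := by
  refine Set.Finite.of_finite_image (f := fun I : Ideal R =>
    I.toAddSubgroup.comap (e : ℤ × ℤ × ℤ →+ R)) ?_ injective_comap_toAddSubgroup.injOn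
  rw [h.image_comap, ← image_matrixLattice hn]
  exact (stableMatrices n).finite_toSet.image _

lemma IsCycleBasis.ncard_idealsOfIndex (h : IsCycleBasis e x) {n : ℕ} (hn : n ≠ 0) :
    (idealsOfIndex R n).ncard = ∑ p ∈ n.divisorsAntidiagonal, ∑ q ∈ p.2.divisorsAntidiagonal,
      (stableEntries p.1 q.1 q.2).card := by
  rw [← Set.ncard_image_of_injective _ (injective_comap_toAddSubgroup (e := e)), h.image_comap,
    ← image_matrixLattice hn, (injOn_matrixLattice n).ncard_image,
    Set.ncard_coe_finset, card_stableMatrices]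

end Ideals

/-! ### From the count to the zeta function -/

section DirichletSeries

open ArithmeticFunction

lemma dirichletMonomial_apply (m n : ℕ) :
    dirichletMonomial m n = if n ≠ 0 ∧ n = m then 1 else 0 := rfl

lemma dirichletMonomial_one : dirichletMonomial 1 = 1 := by
  ext n
  rw [dirichletMonomial_apply, one_apply]
  exact if_congr (by omega) rfl rfl

lemma dirichletMonomial_mul (m k : ℕ) :
    dirichletMonomial m * dirichletMonomial k = dirichletMonomial (m * k) := by
  ext n
  simp only [mul_apply, dirichletMonomial_apply]
  by_cases hn : n ≠ 0 ∧ n = m * k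
  · obtain ⟨hn, rfl⟩ := hn
    rw [if_pos ⟨hn, rfl⟩, Finset.sum_eq_single_of_mem (m, k) (by simpa using hn)]
    · simp [left_ne_zero_of_mul hn, right_ne_zero_of_mul hn]
    · rintro ⟨p, q⟩ - hpq
      rw [Ne, Prod.mk.injEq] at hpq
      by_cases hp : p = m
      · have : q ≠ k := fun h => hpq ⟨hp, h⟩
        simp [this]
      · simp [hp]
  · rw [if_neg hn]
    refine Finset.sum_eq_zero fun p hp => ?_
    rw [Nat.mem_divisorsAntidiagonal] at hp
    split_ifs with h1 h2
    · exact absurd ⟨hp.2, by rw [← hp.1, h1.2, h2.2]⟩ hn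
    all_goals simp

lemma dirichletMonomial_pow (m i : ℕ) :
    dirichletMonomial (m ^ i) = dirichletMonomial m ^ i := by
  induction i with
  | zero => rw [pow_zero, pow_zero, dirichletMonomial_one]
  | succ i ih => rw [pow_succ, pow_succ, ← ih, dirichletMonomial_mul]

lemma dirichletMonomial_mul_zeta_apply {m n : ℕ} (hn : n ≠ 0) :
    (dirichletMonomial m * (zeta : ArithmeticFunction ℤ)) n = if m ∣ n then 1 else 0 := by
  rw [coe_mul_zeta_apply]
  simp only [dirichletMonomial_apply]
  rw [Finset.sum_congr rfl (g := fun i => if i = m then (1 : ℤ) else 0), Finset.sum_ite_eq']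
  · simp [hn]
  · intro i hi
    simp [(Nat.pos_of_mem_divisors hi).ne']

/-- A coefficient of an arithmetic function, as an additive map. -/
def coeffHom (n : ℕ) : ArithmeticFunction ℤ →+ ℤ where
  toFun f := f n
  map_zero' := rfl
  map_add' _ _ := rfl

lemma intSmul_apply (z : ℤ) (f : ArithmeticFunction ℤ) (n : ℕ) : (z • f) n = z * f n :=
  (map_zsmul (coeffHom n) z f).trans (smul_eq_mul z (f n))

lemma intSub_apply (f g : ArithmeticFunction ℤ) (n : ℕ) : (f - g) n = f n - g n :=
  map_sub (coeffHom n) f g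

lemma IsCycleBasis.idealZeta_eq {R : Type*} [Ring R] {e : ℤ × ℤ × ℤ ≃+ R} {x : R}
    (h : IsCycleBasis e x) : idealZeta R =
      ((16 : ℤ) • dirichletMonomial (2 ^ 8) - (16 : ℤ) • dirichletMonomial (2 ^ 7)
        + (12 : ℤ) • dirichletMonomial (2 ^ 6) + (2 : ℤ) • dirichletMonomial (2 ^ 4)
        + (3 : ℤ) • dirichletMonomial (2 ^ 2) - (2 : ℤ) • dirichletMonomial 2 + 1)
        * (zeta : ArithmeticFunction ℤ) ^ 3 := by
  set F : ℕ → ArithmeticFunction ℤ := fun i =>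
    dirichletMonomial 2 ^ i * (zeta : ArithmeticFunction ℤ) with hF
  have hFI (i n : ℕ) (hn : n ≠ 0) : F i n = if 2 ^ i ∣ n then 1 else 0 := by
    rw [hF]
    dsimp only
    rw [← dirichletMonomial_pow, dirichletMonomial_mul_zeta_apply hn]
  let T : ℕ → ℕ → ℕ → ArithmeticFunction ℤ := fun i j k => F i * (F j * F k)
  have hT (i j k n : ℕ) : T i j k n = ∑ p ∈ n.divisorsAntidiagonal,
      ∑ q ∈ p.2.divisorsAntidiagonal, F i p.1 * (F j q.1 * F k q.2) := by
    simp only [T, mul_apply, Finset.mul_sum]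
  -- Each `T i j k` is `2 ^ (-(i + j + k) s) ζ(s) ^ 3`. The right side is `card_stableEntries_eq`
  -- multiplied out, with `i, j, k` the exponents for `a, b, c`.
  have key : ((16 : ℤ) • dirichletMonomial (2 ^ 8) - (16 : ℤ) • dirichletMonomial (2 ^ 7)
        + (12 : ℤ) • dirichletMonomial (2 ^ 6) + (2 : ℤ) • dirichletMonomial (2 ^ 4)
        + (3 : ℤ) • dirichletMonomial (2 ^ 2) - (2 : ℤ) • dirichletMonomial 2 + 1)
        * (zeta : ArithmeticFunction ℤ) ^ 3 =
      T 0 0 0 - T 0 1 0 + (2 : ℤ) • T 1 1 0 - T 0 0 1 + T 0 1 1 - (2 : ℤ) • T 1 1 1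
      + (2 : ℤ) • T 1 1 1 + (4 : ℤ) • T 2 1 1 - (2 : ℤ) • T 1 1 2 - (4 : ℤ) • T 2 1 2
      + (8 : ℤ) • T 2 2 2 + (4 : ℤ) • T 1 2 2 - (4 : ℤ) • T 1 2 3
      + (16 : ℤ) • T 2 3 3 + (8 : ℤ) • T 1 2 3 - (8 : ℤ) • T 2 2 3 - (8 : ℤ) • T 1 3 3 := by
    simp only [T, hF, dirichletMonomial_pow, zsmul_eq_mul]
    push_cast
    ring
  rw [key]
  ext n
  by_cases hn : n = 0
  · simp [hn]
  have hcard : idealZeta R n = ∑ p ∈ n.divisorsAntidiagonal, ∑ q ∈ p.2.divisorsAntidiagonal,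
      ((stableEntries p.1 q.1 q.2).card : ℤ) := by
    have h1 : idealZeta R n = if n = 0 then 0 else ((idealsOfIndex R n).ncard : ℤ) := rfl
    rw [h1, if_neg hn, h.ncard_idealsOfIndex hn]
    push_cast
    rfl
  rw [hcard]
  simp only [ArithmeticFunction.add_apply, intSub_apply, intSmul_apply, hT]
  simp only [Finset.mul_sum, ← Finset.sum_add_distrib, ← Finset.sum_sub_distrib]
  refine Finset.sum_congr rfl fun p hp => Finset.sum_congr rfl fun q hq => ?_
  rw [Nat.mem_divisorsAntidiagonal] at hp hq
  have hp1 : p.1 ≠ 0 := left_ne_zero_of_mul (hp.1 ▸ hp.2)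
  have hq1 : q.1 ≠ 0 := left_ne_zero_of_mul (hq.1 ▸ hq.2)
  have hq2 : q.2 ≠ 0 := right_ne_zero_of_mul (hq.1 ▸ hq.2)
  rw [card_stableEntries_eq (Nat.pos_of_ne_zero hp1) (Nat.pos_of_ne_zero hq1)
    (Nat.pos_of_ne_zero hq2) (fun i n => F i n) hFI]
  -- The trivial indicator fills the places of the variables missing from a monomial.
  have h0 {n : ℕ} (hn : n ≠ 0) : F 0 n = 1 := by simp [hFI 0 n hn]
  rw [h0 hp1, h0 hq1, h0 hq2]
  ring

lemma LSeriesHasSum_dirichletMonomial {n : ℕ} (hn : n ≠ 0) (s : ℂ) :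
    LSeriesHasSum (fun m => (dirichletMonomial n m : ℂ)) s ((n : ℂ) ^ (-s)) := by
  have h : (n : ℂ) ^ (-s) = LSeries.term (fun m => (dirichletMonomial n m : ℂ)) s n := by
    simp [dirichletMonomial_apply, hn, Complex.cpow_neg]
  rw [h]
  refine hasSum_single n fun m hm => ?_
  by_cases hm0 : m = 0
  · simp [hm0]
  · simp [LSeries.term_of_ne_zero hm0, dirichletMonomial_apply, hm]

lemma LSeriesHasSum_intCast_mul {f g : ArithmeticFunction ℤ} {s a b : ℂ}
    (hf : LSeriesHasSum (fun n => (f n : ℂ)) s a) (hg : LSeriesHasSum (fun n => (g n : ℂ)) s b) :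
    LSeriesHasSum (fun n => ((f * g) n : ℂ)) s (a * b) := by
  have h := LSeriesHasSum_mul (f := (f : ArithmeticFunction ℂ)) (g := (g : ArithmeticFunction ℂ))
    (by simpa using hf) (by simpa using hg)
  rw [← intCoe_mul] at h
  simpa using h

lemma LSeriesHasSum_cycleGraph_four {s : ℂ} (hs : 1 < s.re) :
    LSeriesHasSum (fun n => ((((16 : ℤ) • dirichletMonomial (2 ^ 8)
        - (16 : ℤ) • dirichletMonomial (2 ^ 7)
        + (12 : ℤ) • dirichletMonomial (2 ^ 6) + (2 : ℤ) • dirichletMonomial (2 ^ 4)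
        + (3 : ℤ) • dirichletMonomial (2 ^ 2) - (2 : ℤ) • dirichletMonomial 2 + 1)
        * (zeta : ArithmeticFunction ℤ) ^ 3 : ArithmeticFunction ℤ) n : ℂ)) s
      ((16 * (2 : ℂ) ^ (-8 * s) - 16 * (2 : ℂ) ^ (-7 * s) + 12 * (2 : ℂ) ^ (-6 * s)
        + 2 * (2 : ℂ) ^ (-4 * s) + 3 * (2 : ℂ) ^ (-2 * s) - 2 * (2 : ℂ) ^ (-s) + 1)
        * riemannZeta s ^ 3) := by
  have hz : LSeriesHasSum (fun n => ((zeta : ArithmeticFunction ℤ) n : ℂ)) s (riemannZeta s) := by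
    simpa using LSeriesHasSum_zeta hs
  have hz3 : LSeriesHasSum (fun n => (((zeta : ArithmeticFunction ℤ) ^ 3) n : ℂ)) s
      (riemannZeta s ^ 3) := by
    rw [pow_succ, pow_two, pow_succ, pow_two]
    exact LSeriesHasSum_intCast_mul (LSeriesHasSum_intCast_mul hz hz) hz
  refine LSeriesHasSum_intCast_mul ?_ hz3
  have hpow (i : ℕ) : LSeriesHasSum (fun m => (dirichletMonomial (2 ^ i) m : ℂ)) s
      ((2 : ℂ) ^ (-(i : ℂ) * s)) := by
    have h := LSeriesHasSum_dirichletMonomial (n := 2 ^ i) (by positivity) s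
    convert h using 1
    have h2 := Complex.natCast_cpow_natCast_mul 2 i (-s)
    push_cast at h2 ⊢
    rw [neg_mul, ← mul_neg, h2]
  have h1 : LSeriesHasSum (fun m => ((1 : ArithmeticFunction ℤ) m : ℂ)) s 1 := by
    have := LSeriesHasSum_dirichletMonomial one_ne_zero s
    simpa [dirichletMonomial_one] using this
  have hsum := ((((((hpow 8).smul 16).sub ((hpow 7).smul 16)).add ((hpow 6).smul 12)).add
    ((hpow 4).smul 2)).add ((hpow 2).smul 3)).sub ((hpow 1).smul 2) |>.add h1
  convert! hsum using 1
  · funext n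
    simp only [ArithmeticFunction.add_apply, intSub_apply, intSmul_apply, Pi.add_apply, Pi.sub_apply, Pi.smul_apply, smul_eq_mul, pow_one]
    push_cast
    rfl
  · simp

end DirichletSeries

/-! ### The adjacency matrix of the 4-cycle -/

section CycleGraph

variable {V : Type*} [Fintype V] [DecidableEq V] (G : SimpleGraph V) [DecidableRel G.Adj]

lemma adjMatrix_submatrix_cycleGraph_four (R : Type*) [Ring R]
    (f : G ≃g SimpleGraph.cycleGraph 4) :
    G.adjMatrix R = Matrix.reindexAlgEquiv ℤ R f.symm.toEquiv
      !![0, 1, 0, 1; 1, 0, 1, 0; 0, 1, 0, 1; 1, 0, 1, 0] := by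
  have h4 (i j : Fin 4) : (if (SimpleGraph.cycleGraph 4).Adj i j then (1 : R) else 0) =
      !![0, 1, 0, 1; 1, 0, 1, 0; 0, 1, 0, 1; 1, 0, 1, 0] i j := by
    fin_cases i <;> fin_cases j <;> first | exact if_pos (by decide) | exact if_neg (by decide)
  ext i j
  rw [SimpleGraph.adjMatrix_apply, Matrix.coe_reindexAlgEquiv, Matrix.reindex_apply,
    Matrix.submatrix_apply, ← h4]
  exact if_congr f.map_adj_iff.symm rfl rfl

lemma hasEigenvalue_toLin'_reindex {K m n : Type*} [Field K] [Fintype m] [DecidableEq m]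
    [Fintype n] [DecidableEq n] (e : m ≃ n) (A : Matrix m m K) (μ : K) :
    Module.End.HasEigenvalue (Matrix.toLin' (Matrix.reindex e e A)) μ ↔
      Module.End.HasEigenvalue (Matrix.toLin' A) μ := by
  rw [Module.End.hasEigenvalue_iff_isRoot_charpoly, Module.End.hasEigenvalue_iff_isRoot_charpoly,
    Matrix.charpoly_toLin', Matrix.charpoly_toLin', Matrix.charpoly_reindex]

lemma hasEigenvalue_adjMatrix_iff (f : G ≃g SimpleGraph.cycleGraph 4) (μ : ℂ) :
    Module.End.HasEigenvalue (Matrix.toLin' (G.adjMatrix ℂ)) μ ↔ μ = 0 ∨ μ = 2 ∨ μ = -2 := by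
  rw [adjMatrix_submatrix_cycleGraph_four G ℂ f, Matrix.coe_reindexAlgEquiv,
    hasEigenvalue_toLin'_reindex, Module.End.hasEigenvalue_iff_isRoot_charpoly,
    Matrix.charpoly_toLin', Polynomial.IsRoot.def, Matrix.eval_charpoly]
  have hdet : (Matrix.scalar (Fin 4) μ -
      !![0, 1, 0, 1; 1, 0, 1, 0; 0, 1, 0, 1; 1, 0, 1, 0]).det = μ ^ 2 * ((μ - 2) * (μ + 2)) := by
    simp [Matrix.det_succ_row_zero, Fin.sum_univ_succ, Fin.succAbove, Matrix.scalar_apply,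
      Matrix.diagonal_apply]
    ring
  rw [hdet]
  simp [sub_eq_zero, add_eq_zero_iff_eq_neg]

section CycleHom

variable {A : Type*} [Ring A] (x : A)

/-- The additive map sending the standard basis of `ℤ³` to `1, x, x ^ 2 - 2 * x`. -/
def cycleHom : ℤ × ℤ × ℤ →+ A :=
  (zmultiplesHom A 1).coprod ((zmultiplesHom A x).coprod (zmultiplesHom A (x * x - (2 : ℤ) • x)))

lemma cycleHom_apply (v : ℤ × ℤ × ℤ) :
    cycleHom x v = v.1 • (1 : A) + (v.2.1 • x + v.2.2 • (x * x - (2 : ℤ) • x)) := rfl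

variable {x}

lemma cycleHom_cycleShift (hx : x * (x * x) = (4 : ℤ) • x) (v : ℤ × ℤ × ℤ) :
    cycleHom x (cycleShift v) = x * cycleHom x v := by
  simp only [cycleHom_apply, cycleShift, mul_add, mul_smul_comm, mul_sub, hx, mul_one]
  module

/-- The span of the three elements is stable under `x` by the cubic relation, hence under
multiplication by its own elements, so it is the whole ring. -/
lemma mem_range_cycleHom (hx : x * (x * x) = (4 : ℤ) • x) {r : A}
    (hr : r ∈ Algebra.adjoin ℤ {x}) : r ∈ (cycleHom x).range := by
  have hmul (r : A) (hr : r ∈ (cycleHom x).range) : x * r ∈ (cycleHom x).range := by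
    obtain ⟨v, rfl⟩ := hr
    exact ⟨cycleShift v, cycleHom_cycleShift hx v⟩
  induction hr using Algebra.adjoin_induction with
  | mem y hy =>
    obtain rfl : y = x := hy
    exact ⟨(0, 1, 0), by simp [cycleHom_apply]⟩
  | algebraMap z => exact ⟨(z, 0, 0), by simp [cycleHom_apply]⟩
  | add r s _ _ hr hs => exact add_mem hr hs
  | mul r s _ _ hr hs =>
    obtain ⟨v, rfl⟩ := hr
    have h : cycleHom x v * s =
        v.1 • s + (v.2.1 • (x * s) + v.2.2 • (x * (x * s) - (2 : ℤ) • (x * s))) := by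
      rw [cycleHom_apply, add_mul, add_mul, smul_mul_assoc, smul_mul_assoc, smul_mul_assoc,
        one_mul, sub_mul, mul_assoc, smul_mul_assoc]
    rw [h]
    have h' := hmul s hs
    exact add_mem (zsmul_mem hs _) (add_mem (zsmul_mem h' _)
      (zsmul_mem (sub_mem (hmul _ h') (zsmul_mem h' _)) _))

lemma exists_isCycleBasis (hx : x * (x * x) = (4 : ℤ) • x)
    (hinj : Function.Injective (cycleHom x)) :
    ∃ (e : ℤ × ℤ × ℤ ≃+ Algebra.adjoin ℤ {x}) (y : Algebra.adjoin ℤ {x}), IsCycleBasis e y := by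
  let y : Algebra.adjoin ℤ {x} := ⟨x, Algebra.self_mem_adjoin_singleton ℤ x⟩
  have hcoe (v : ℤ × ℤ × ℤ) : (cycleHom y v : A) = cycleHom x v := rfl
  have hbij : Function.Bijective (cycleHom y) := by
    refine ⟨fun v w h => hinj ?_, fun r => ?_⟩
    · rw [← hcoe, ← hcoe, h]
    · obtain ⟨v, hv⟩ := mem_range_cycleHom hx r.2
      exact ⟨v, Subtype.ext hv⟩
  refine ⟨AddEquiv.ofBijective _ hbij, y, ?_, fun v => ?_⟩
  · simp [cycleHom_apply]
  · exact cycleHom_cycleShift (Subtype.ext hx) v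

end CycleHom

lemma exists_isCycleBasis_matrixRing (f : G ≃g SimpleGraph.cycleGraph 4) :
    ∃ (e : ℤ × ℤ × ℤ ≃+ matrixRing (G.adjMatrix ℤ)) (x : matrixRing (G.adjMatrix ℤ)),
      IsCycleBasis e x := by
  rw [adjMatrix_submatrix_cycleGraph_four G ℤ f]
  set φ := Matrix.reindexAlgEquiv ℤ ℤ f.symm.toEquiv
  set C : Matrix (Fin 4) (Fin 4) ℤ := !![0, 1, 0, 1; 1, 0, 1, 0; 0, 1, 0, 1; 1, 0, 1, 0] with hC
  refine exists_isCycleBasis ?_ ((injective_iff_map_eq_zero _).2 ?_)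
  · rw [← map_mul, ← map_mul, ← map_zsmul]
    congr 1
    rw [hC]
    decide
  · rintro ⟨u, v, w⟩ h
    have h' : cycleHom C (u, v, w) = 0 := by
      apply φ.injective
      rw [map_zero, ← h]
      simp only [cycleHom_apply, map_add, map_sub, map_zsmul, map_mul, map_one]
    have hCC : C * C = !![2, 0, 2, 0; 0, 2, 0, 2; 2, 0, 2, 0; 0, 2, 0, 2] := by
      rw [hC]
      decide
    rw [cycleHom_apply, hCC] at h'
    -- These three entries are `u + 2 * w`, `v - 2 * w` and `2 * w`, whose vanishing forces `u = v =
    -- w = 0`.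
    have h00 := congrFun (congrFun h' 0) 0
    have h01 := congrFun (congrFun h' 0) 1
    have h02 := congrFun (congrFun h' 0) 2
    simp only [Matrix.add_apply, Matrix.smul_apply, Matrix.sub_apply, Matrix.one_apply] at h00 h01 h02
    simp [hC] at h00 h01 h02
    ext <;> simp <;> omega

end CycleGraph

/-- Let `B` be the adjacency matrix of a cycle of length 4. It has the eigenvalues `0, 2, -2`,
the ring `ℤ[B]` has only finitely many ideals of each index `n ≥ 1`, and its zeta function is as
displayed, as a formal Dirichlet series and as a convergent one on `Re s > 1`. -/
theorem mainTheorem8 {V : Type*} [Fintype V] [DecidableEq V] (G : SimpleGraph V)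
    [DecidableRel G.Adj] (hG : Nonempty (G ≃g SimpleGraph.cycleGraph 4)) :
    {μ : ℂ | Module.End.HasEigenvalue (Matrix.toLin' (G.adjMatrix ℂ)) μ} = {0, 2, -2} ∧
    (∀ n : ℕ, 1 ≤ n → (idealsOfIndex (matrixRing (G.adjMatrix ℤ)) n).Finite) ∧
    idealZeta (matrixRing (G.adjMatrix ℤ)) =
      ((16 : ℤ) • dirichletMonomial (2 ^ 8) - (16 : ℤ) • dirichletMonomial (2 ^ 7)
        + (12 : ℤ) • dirichletMonomial (2 ^ 6) + (2 : ℤ) • dirichletMonomial (2 ^ 4)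
        + (3 : ℤ) • dirichletMonomial (2 ^ 2) - (2 : ℤ) • dirichletMonomial 2 + 1)
        * (ArithmeticFunction.zeta : ArithmeticFunction ℤ) ^ 3 ∧
    ∀ s : ℂ, 1 < s.re →
      LSeriesHasSum (fun n => (idealZeta (matrixRing (G.adjMatrix ℤ)) n : ℂ)) s
        ((16 * (2 : ℂ) ^ (-8 * s) - 16 * (2 : ℂ) ^ (-7 * s) + 12 * (2 : ℂ) ^ (-6 * s)
          + 2 * (2 : ℂ) ^ (-4 * s) + 3 * (2 : ℂ) ^ (-2 * s) - 2 * (2 : ℂ) ^ (-s) + 1)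
          * riemannZeta s ^ 3) := by
  obtain ⟨f⟩ := hG
  obtain ⟨e, x, h⟩ := exists_isCycleBasis_matrixRing G f
  refine ⟨?_, fun n hn => h.finite_idealsOfIndex (Nat.one_le_iff_ne_zero.1 hn), h.idealZeta_eq,
    fun s hs => ?_⟩
  · ext μ
    exact hasEigenvalue_adjMatrix_iff G f μ
  · rw [h.idealZeta_eq]
    exact LSeriesHasSum_cycleGraph_four hs
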